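/- Let $p$ be a prime and $C_p$ the cyclic group of order $p$. A $C_p$-Tambara functor $\underline{T}$ consists of commutative rings $\underline{T}(C_p/C_p)$ (the fixed level) and $\underline{T}(C_p/e)$ (the underlying level), an action of $C_p$ on $\underline{T}(C_p/e)$ by ring automorphisms, a ring homomorphism $\operatorname{res}\colon\underline{T}(C_p/C_p)\to\underline{T}(C_p/e)$, an additive map $\operatorname{tr}\colon\underline{T}(C_p/e)\to\underline{T}(C_p/C_p)$ and a multiplicative, unit-preserving map $\operatorname{nm}\colon\underline{T}(C_p/e)\to\underline{T}(C_p/C_p)$, such that for all $a\in\underline{T}(C_p/C_p)$, $b,c\in\underline{T}(C_p/e)$ and $g\in C_p$: $$g\cdot\operatorname{res}(a)=\operatorname{res}(a),\qquad \operatorname{tr}(g\cdot b)=\operatorname{tr}(b),\qquad \operatorname{nm}(g\cdot b)=\operatorname{nm}(b),\qquad \operatorname{tr}(\operatorname{res}(a)\,b)=a\operatorname{tr}(b),$$ $$\operatorname{res}\operatorname{tr}(b)=\sum_{h\in C_p}h\cdot b,\qquad \operatorname{res}\operatorname{nm}(b)=\prod_{h\in C_p}h\cdot b,$$ $$\operatorname{nm}(b+c)=\operatorname{nm}(b)+\operatorname{nm}(c)+\sum_{[S]}\operatorname{tr}\Big(\prod_{h\in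 S}h\cdot b\ \prod_{h\in C_p\smallsetminus S}h\cdot c\Big),$$ where $[S]$ runs over the orbits, under translation by $C_p$, of the nonempty proper subsets $S\subsetneq C_p$. A morphism is a pair of ring homomorphisms, one on each level, commuting with $\operatorname{res}$, $\operatorname{tr}$, $\operatorname{nm}$ and the actions. A $C_p$-Tambara functor $\underline{F}$ is free on a fixed generator $x\in\underline{F}(C_p/C_p)$ if for every $C_p$-Tambara functor $\underline{T}$ and every $a\in\underline{T}(C_p/C_p)$ there is exactly one morphism $\underline{F}\to\underline{T}$ sending $x$ to $a$. **Proposition.** There is exactly one $C_p$-Tambara functor with fixed level $\mathbb{Z}[t,n,x]/(t^2=pt,\ tx^p=tn)$, underlying level $\mathbb{Z}[x]$, and structure maps satisfying $$\operatorname{res}(t)=p,\quad \operatorname{res}(x)=x,\quad \operatorname{res}(n)=x^p,\quad \operatorname{tr}(x)=tx,\quad \operatorname{nm}(x)=n,\quad g\cdot f=f\ \text{ for all } g\in C_p,\ f\in\mathbb{Z}[x],$$ and it is free on the fixed generator $x\in\mathbb{Z}[t,n,x]/(t^2=pt,\ tx^p=tn)$. -/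

import Mathlib

open scoped Pointwise Polynomial

universe u v

/-- The cyclic group `C_p` of order `p`, written multiplicatively. -/
abbrev Cp (p : ℕ) : Type := Multiplicative (ZMod p)

/-- `R` contains exactly one representative of each `C_p`-orbit (under translation) of nonempty
proper subsets of `C_p`. A nonempty proper subset is the same as a non-constant map from `C_p` to a
two-element set, and for `p` prime its stabilizer is trivial. -/
def IsOrbitTransversal (p : ℕ) [Fact p.Prime] (R : Finset (Finset (Cp p))) : Prop :=
  (∀ S ∈ R, S.Nonempty ∧ S ≠ Finset.univ) ∧
  ∀ S : Finset (Cp p), S.Nonempty → S ≠ Finset.univ → ∃! S', S' ∈ R ∧ ∃ g : Cp p, S' = g • S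

/-- A `C_p`-Mackey functor whose fixed level (value at `C_p/C_p`) is the abelian group `A` and whose
underlying level (value at `C_p/e`) is `B`, where both are commutative rings and the structure maps
make it a Green functor. -/
@[ext]
structure CpGreenFunctor (p : ℕ) [Fact p.Prime] (A : Type*) (B : Type*)
    [CommRing A] [CommRing B] where
  /-- restriction, a ring homomorphism -/
  res : A →+* B
  /-- transfer, an additive homomorphism -/
  tr : B →+ A
  /-- the action of `C_p` on the underlying level by ring automorphisms -/
  conj : Cp p →* RingAut B
  conj_res : ∀ (g : Cp p) (a : A), conj g (res a) = res a
  tr_conj : ∀ (g : Cp p) (b : B), tr (conj g b) = tr b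
  /-- double coset formula -/
  res_tr : ∀ b : B, res (tr b) = ∑ g : Cp p, conj g b
  /-- the transfer is linear over the fixed level -/
  tr_res_mul : ∀ (a : A) (b : B), tr (res a * b) = a * tr b

/-- A `C_p`-Tambara functor with fixed level `A` and underlying level `B`: a Green functor with a
multiplicative norm. -/
@[ext]
structure CpTambaraFunctor (p : ℕ) [Fact p.Prime] (A : Type*) (B : Type*)
    [CommRing A] [CommRing B] extends CpGreenFunctor p A B where
  /-- norm, a multiplicative homomorphism -/
  nm : B →* A
  nm_conj : ∀ (g : Cp p) (b : B), nm (conj g b) = nm b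
  /-- multiplicative double coset formula -/
  res_nm : ∀ b : B, res (nm b) = ∏ g : Cp p, conj g b
  /-- distributive law for the norm of a sum: the correction term is the sum, over the free orbits of
  maps from `C_p` to `{b, c}`, of the transfer of the corresponding product of conjugates. The
  transfer does not depend on the representative chosen in the orbit. -/
  nm_add : ∀ R : Finset (Finset (Cp p)), IsOrbitTransversal p R → ∀ b c : B,
    nm (b + c) = nm b + nm c + ∑ S ∈ R, tr ((∏ g ∈ S, conj g b) * ∏ g ∈ Sᶜ, conj g c)

/-- A morphism of `C_p`-Tambara functors: a pair of ring homomorphisms that commute with all the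
structure maps. -/
@[ext]
structure CpTambaraHom {p : ℕ} [Fact p.Prime] {A B A' B' : Type*} [CommRing A] [CommRing B]
    [CommRing A'] [CommRing B'] (T : CpTambaraFunctor p A B) (T' : CpTambaraFunctor p A' B') where
  /-- the map on fixed levels -/
  fixed : A →+* A'
  /-- the map on underlying levels -/
  underlying : B →+* B'
  map_res : ∀ a, underlying (T.res a) = T'.res (fixed a)
  map_tr : ∀ b, fixed (T.tr b) = T'.tr (underlying b)
  map_nm : ∀ b, fixed (T.nm b) = T'.nm (underlying b)
  map_conj : ∀ g b, underlying (T.conj g b) = T'.conj g (underlying b)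

/-- `T` is the free `C_p`-Tambara functor on the fixed generator `x`: it represents, through `x`,
evaluation at the fixed level. -/
def CpTambaraFunctor.IsFreeOnFixed.{w, z, w', z'} {p : ℕ} [Fact p.Prime] {A : Type w'}
    {B : Type z'} [CommRing A] [CommRing B] (T : CpTambaraFunctor p A B) (x : A) : Prop :=
  ∀ (A' : Type w) (B' : Type z) [CommRing A'] [CommRing B'] (T' : CpTambaraFunctor p A' B')
    (a : A'), ∃! φ : CpTambaraHom T T', φ.fixed x = a

/-- The ideal of `ℤ[t, n, x]` generated by `t² - pt` and `tx^p - tn`; here the variables `t`, `n`,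
`x` have the indices `0`, `1`, `2`. -/
noncomputable def fixedIdeal (p : ℕ) : Ideal (MvPolynomial (Fin 3) ℤ) :=
  Ideal.span
    {(MvPolynomial.X 0 ^ 2 - (p : MvPolynomial (Fin 3) ℤ) * MvPolynomial.X 0),
      (MvPolynomial.X 0 * MvPolynomial.X 2 ^ p - MvPolynomial.X 0 * MvPolynomial.X 1)}

/-- The ring `ℤ[t, n, x] / (t² = pt, tx^p = tn)`. -/
abbrev FixedRing (p : ℕ) : Type := MvPolynomial (Fin 3) ℤ ⧸ fixedIdeal p

namespace FixedRing

/-- The class of `t`. -/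
noncomputable def t (p : ℕ) : FixedRing p := Ideal.Quotient.mk (fixedIdeal p) (MvPolynomial.X 0)

/-- The class of `n`. -/
noncomputable def n (p : ℕ) : FixedRing p := Ideal.Quotient.mk (fixedIdeal p) (MvPolynomial.X 1)

/-- The class of `x`. -/
noncomputable def x (p : ℕ) : FixedRing p := Ideal.Quotient.mk (fixedIdeal p) (MvPolynomial.X 2)

end FixedRing

/-- The formulas for the structure maps of a `C_p`-Tambara functor with fixed level
`ℤ[t, n, x] / (t² = pt, tx^p = tn)` and underlying level `ℤ[x]`. -/
structure HasLewisDiagram {p : ℕ} [Fact p.Prime] (T : CpTambaraFunctor p (FixedRing p) ℤ[X]) :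
    Prop where
  conj_eq : ∀ (g : Cp p) (f : ℤ[X]), T.conj g f = f
  res_t : T.res (FixedRing.t p) = (p : ℤ[X])
  res_x : T.res (FixedRing.x p) = Polynomial.X
  res_n : T.res (FixedRing.n p) = Polynomial.X ^ p
  tr_X : T.tr Polynomial.X = FixedRing.t p * FixedRing.x p
  nm_X : T.nm Polynomial.X = FixedRing.n p

/-! An element of the fixed ring is detected by two ghost coordinates, each in a domain: its
restriction in `ℤ[x]` and its class modulo `t` in `ℤ[x][n]` (`FixedRing.ghost_ext`). The norm of `f`
is then forced to have coordinates `f ^ p` and `f(n)`; such an element exists because `f ^ p ≡ f(x ^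
p)` mod `p`. The Tambara identities for the norm are checked on coordinates: transfers vanish modulo
`t`, and under restriction the distributive law is the binomial theorem grouped by free orbits.

Uniqueness and freeness rest on one principle: where transfers and conjugations are respected, the
elements with preserved norm form a subring, so for `ℤ[x]` only the norm of `x` matters. A morphism
sending `x` to `a` must send `t` to `tr 1` and `n` to `nm (res a)`, and the two relations hold for
these elements in any Tambara functor. -/

namespace IsOrbitTransversal

/-! ### Free orbits of proper subsets -/

variable {p : ℕ} [Fact p.Prime]

theorem smul_eq_self_imp {S : Finset (Cp p)} (hne : S.Nonempty) (huniv : S ≠ Finset.univ)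
    {g : Cp p} (hg : g • S = S) : g = 1 := by
  have hprime : (Nat.card (Cp p)).Prime := by
    simpa [Cp] using (Fact.out : p.Prime)
  have : Fact (Nat.card (Cp p)).Prime := ⟨hprime⟩
  rcases (MulAction.stabilizer (Cp p) S).eq_bot_or_eq_top_of_prime_card with h | h
  · have : g ∈ MulAction.stabilizer (Cp p) S := hg
    rwa [h, Subgroup.mem_bot] at this
  · exfalso
    apply huniv
    obtain ⟨s, hs⟩ := hne
    rw [Finset.eq_univ_iff_forall]
    intro y
    have hy : y * s⁻¹ ∈ MulAction.stabilizer (Cp p) S := by rw [h]; trivial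
    have hy' : (y * s⁻¹) • S = S := hy
    rw [← hy']
    simpa using Finset.smul_mem_smul_finset (a := y * s⁻¹) hs

theorem smul_ne_univ {S : Finset (Cp p)} (g : Cp p) (h : S ≠ Finset.univ) :
    g • S ≠ Finset.univ := by
  intro h'
  apply h
  rw [← Finset.card_eq_iff_eq_univ] at h' ⊢
  rwa [Finset.card_smul_finset] at h'

variable (p) in
theorem exists_transversal : ∃ R : Finset (Finset (Cp p)), IsOrbitTransversal p R := by
  classical
  let s := MulAction.orbitRel (Cp p) (Finset (Cp p))
  let rep : Finset (Cp p) → Finset (Cp p) := fun S => (Quotient.mk s S).out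
  have hrep : ∀ S, ∃ g : Cp p, rep S = g • S := by
    intro S
    obtain ⟨g, hg⟩ : s (rep S) S := Quotient.exact (Quotient.out_eq (Quotient.mk s S))
    exact ⟨g, hg.symm⟩
  have hsmul : ∀ (g : Cp p) S, rep (g • S) = rep S := by
    intro g S
    have : Quotient.mk s (g • S) = Quotient.mk s S := Quotient.sound ⟨g, rfl⟩
    simp only [rep, this]
  refine ⟨Finset.univ.filter fun S => S.Nonempty ∧ S ≠ Finset.univ ∧ rep S = S, ?_, ?_⟩
  · intro S hS
    have := (Finset.mem_filter.1 hS).2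
    exact ⟨this.1, this.2.1⟩
  · intro S h1 h2
    obtain ⟨g, hg⟩ := hrep S
    refine ⟨rep S, ⟨Finset.mem_filter.2 ⟨Finset.mem_univ _, ?_, ?_, ?_⟩, g, hg⟩, ?_⟩
    · rw [hg]; exact h1.smul_finset
    · rw [hg]; exact smul_ne_univ g h2
    · conv_lhs => rw [hg, hsmul]
    · rintro S' ⟨hS', k, rfl⟩
      rw [← (Finset.mem_filter.1 hS').2.2.2, hsmul]

/-- An invariant function sums over all nonempty proper subsets to `p` times its sum over a
transversal. -/
theorem sum_proper {R : Finset (Finset (Cp p))} (hR : IsOrbitTransversal p R) {M : Type*}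
    [AddCommMonoid M] (f : Finset (Cp p) → M) (hf : ∀ (g : Cp p) S, f (g • S) = f S) :
    ∑ S : Finset (Cp p) with S.Nonempty ∧ S ≠ Finset.univ, f S = p • ∑ S ∈ R, f S := by
  classical
  have h1 : p • ∑ S ∈ R, f S = ∑ x ∈ R ×ˢ (Finset.univ : Finset (Cp p)), f (x.2 • x.1) := by
    rw [Finset.sum_product, Finset.smul_sum]
    refine Finset.sum_congr rfl fun S _ => ?_
    simp [hf, Cp]
  rw [h1]
  symm
  refine Finset.sum_bij (fun x _ => x.2 • x.1) ?_ ?_ ?_ (fun _ _ => rfl)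
  · rintro ⟨S, g⟩ hx
    obtain ⟨hS, -⟩ := Finset.mem_product.1 hx
    obtain ⟨hne, hu⟩ := hR.1 S hS
    exact Finset.mem_filter.2 ⟨Finset.mem_univ _, hne.smul_finset, smul_ne_univ g hu⟩
  · rintro ⟨S, g⟩ hx ⟨S', g'⟩ hx' h
    obtain ⟨hS, -⟩ := Finset.mem_product.1 hx
    obtain ⟨hS', -⟩ := Finset.mem_product.1 hx'
    obtain ⟨hne, hu⟩ := hR.1 S hS
    change g • S = g' • S' at h
    have hSS : S = S' := (hR.2 S hne hu).unique ⟨hS, 1, (one_smul _ _).symm⟩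
      ⟨hS', g'⁻¹ * g, by rw [mul_smul, h, inv_smul_smul]⟩
    subst hSS
    have : g'⁻¹ * g = 1 := smul_eq_self_imp hne hu (by rw [mul_smul, h, inv_smul_smul])
    rw [inv_mul_eq_one] at this
    rw [this]
  · intro S hS
    obtain ⟨-, hne, hu⟩ := Finset.mem_filter.1 hS
    obtain ⟨S', ⟨hS', g, rfl⟩, -⟩ := hR.2 S hne hu
    exact ⟨(g • S, g⁻¹), Finset.mem_product.2 ⟨hS', Finset.mem_univ _⟩, inv_smul_smul _ _⟩

/-- Expand the power over all subsets of `Cp p`: the full and empty sets give the pure powers, and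
the remaining terms depend only on cardinality, hence are constant on orbits of size `p`. -/
theorem add_pow_eq {R : Finset (Finset (Cp p))} (hR : IsOrbitTransversal p R) {B : Type*}
    [CommRing B] (b c : B) :
    (b + c) ^ p = b ^ p + c ^ p + p * ∑ S ∈ R, b ^ S.card * c ^ Sᶜ.card := by
  classical
  have hcard : Fintype.card (Cp p) = p := by simp [Cp]
  have h := Finset.sum_pow_mul_eq_add_pow b c (Finset.univ : Finset (Cp p))
  rw [Finset.powerset_univ, Finset.card_univ, hcard] at h
  have hsum := hR.sum_proper (fun S => b ^ S.card * c ^ Sᶜ.card) fun g S => by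
    simp [Finset.card_compl]
  rw [nsmul_eq_mul] at hsum
  rw [← h, ← hsum, ← Finset.sum_filter_add_sum_filter_not Finset.univ
    (fun S : Finset (Cp p) => S.Nonempty ∧ S ≠ Finset.univ), add_comm]
  congr 1
  · have hne : (∅ : Finset (Cp p)) ≠ Finset.univ := Finset.univ_nonempty.ne_empty.symm
    have : (Finset.univ.filter fun S : Finset (Cp p) => ¬(S.Nonempty ∧ S ≠ Finset.univ))
        = {Finset.univ, ∅} := by
      ext S
      simp only [Finset.mem_filter, Finset.mem_univ, true_and, Finset.mem_insert,
        Finset.mem_singleton, Finset.nonempty_iff_ne_empty]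
      tauto
    rw [this, Finset.sum_pair hne.symm]
    simp [hcard]
  · refine Finset.sum_congr rfl fun S _ => ?_
    rw [Finset.card_compl, hcard]

end IsOrbitTransversal

/-! ### Norms are determined on ring generators -/

namespace CpTambaraFunctor

variable {p : ℕ} [Fact p.Prime] {A B A' B' : Type*} [CommRing A] [CommRing B] [CommRing A']
  [CommRing B']

theorem nm_zero (T : CpTambaraFunctor p A B) : T.nm 0 = 0 := by
  obtain ⟨R, hR⟩ := IsOrbitTransversal.exists_transversal p
  have h := T.nm_add R hR 0 0
  rw [Finset.sum_eq_zero, add_zero, add_zero, left_eq_add] at h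
  · exact h
  · intro S hS
    obtain ⟨s, hs⟩ := (hR.1 S hS).1
    rw [Finset.prod_eq_zero hs (map_zero _), zero_mul, map_zero]

/-- The elements whose norm is preserved by a pair of ring homomorphisms that commute with transfer
and conjugation. -/
def normEqualizer (T : CpTambaraFunctor p A B) (T' : CpTambaraFunctor p A' B') (α : A →+* A')
    (β : B →+* B') (htr : ∀ b, α (T.tr b) = T'.tr (β b))
    (hconj : ∀ g b, β (T.conj g b) = T'.conj g (β b)) : Subring B :=
  have key : ∀ R : Finset (Finset (Cp p)), ∀ b c,
      α (∑ S ∈ R, T.tr ((∏ g ∈ S, T.conj g b) * ∏ g ∈ Sᶜ, T.conj g c)) =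
        ∑ S ∈ R, T'.tr ((∏ g ∈ S, T'.conj g (β b)) * ∏ g ∈ Sᶜ, T'.conj g (β c)) := by
    intro R b c
    simp only [map_sum, htr, map_mul, map_prod, hconj]
  { carrier := {b | α (T.nm b) = T'.nm (β b)}
    mul_mem' := by
      intro b c hb hc
      simp only [Set.mem_ofPred_eq] at *
      simp only [map_mul, hb, hc]
    one_mem' := by simp
    zero_mem' := by simp [nm_zero]
    add_mem' := by
      intro b c hb hc
      obtain ⟨R, hR⟩ := IsOrbitTransversal.exists_transversal p
      simp only [Set.mem_ofPred_eq] at *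
      rw [map_add β, T.nm_add R hR, T'.nm_add R hR, map_add, map_add, key, hb, hc]
    neg_mem' := by
      intro b hb
      obtain ⟨R, hR⟩ := IsOrbitTransversal.exists_transversal p
      simp only [Set.mem_ofPred_eq] at *
      -- Both expansions of the norm of `b + (-b) = 0` have matching terms apart from the norm of
      -- `-b`, so cancellation identifies that one too.
      have h := congrArg α (T.nm_add R hR b (-b))
      have h' := T'.nm_add R hR (β b) (-β b)
      rw [add_neg_cancel, nm_zero, map_zero, map_add, map_add, key, map_neg β, hb] at h
      rw [add_neg_cancel, nm_zero, h] at h'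
      rw [map_neg β]
      exact add_left_cancel (add_right_cancel h') }

theorem nm_compat_of_X {A A' B' : Type*} [CommRing A] [CommRing A'] [CommRing B']
    (T : CpTambaraFunctor p A ℤ[X]) (T' : CpTambaraFunctor p A' B') (α : A →+* A')
    (β : ℤ[X] →+* B') (htr : ∀ b, α (T.tr b) = T'.tr (β b))
    (hconj : ∀ g b, β (T.conj g b) = T'.conj g (β b))
    (hX : α (T.nm Polynomial.X) = T'.nm (β Polynomial.X)) (f : ℤ[X]) :
    α (T.nm f) = T'.nm (β f) := by
  change f ∈ normEqualizer T T' α β htr hconj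
  induction f using Polynomial.induction_on with
  | C a => simp
  | add f g hf hg => exact add_mem hf hg
  | monomial k a _ =>
    refine mul_mem (by simp) (pow_mem ?_ _)
    exact hX

end CpTambaraFunctor

/-! ### The fixed ring and its ghost coordinates -/

namespace FixedRing

open Polynomial

variable (p : ℕ)

theorem t_sq : t p * t p = p * t p := by
  have : Ideal.Quotient.mk (fixedIdeal p)
      (MvPolynomial.X 0 ^ 2 - (p : MvPolynomial (Fin 3) ℤ) * MvPolynomial.X 0) = 0 :=
    Ideal.Quotient.eq_zero_iff_mem.2 (Ideal.subset_span (by simp))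
  rw [map_sub, sub_eq_zero, map_pow, map_mul, map_natCast, pow_two] at this
  exact this

theorem t_mul_x_pow : t p * x p ^ p = t p * n p := by
  have : Ideal.Quotient.mk (fixedIdeal p)
      (MvPolynomial.X 0 * MvPolynomial.X 2 ^ p - MvPolynomial.X 0 * MvPolynomial.X 1) = 0 :=
    Ideal.Quotient.eq_zero_iff_mem.2 (Ideal.subset_span (by simp))
  rw [map_sub, sub_eq_zero, map_mul, map_mul, map_pow] at this
  exact this

variable {p} in
theorem ringHom_ext {S : Type*} [CommRing S] {f g : FixedRing p →+* S} (ht : f (t p) = g (t p))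
    (hn : f (n p) = g (n p)) (hx : f (x p) = g (x p)) : f = g := by
  refine Ideal.Quotient.ringHom_ext (MvPolynomial.ringHom_ext (fun r => by simp) fun i => ?_)
  fin_cases i
  exacts [ht, hn, hx]

/-- The homomorphism out of `ℤ[t, n, x] / (t² = pt, tx^p = tn)` with given values on the
generators. -/
noncomputable def lift {S : Type*} [CommRing S] (t' n' x' : S) (h1 : t' * t' = p * t')
    (h2 : t' * x' ^ p = t' * n') : FixedRing p →+* S :=
  Ideal.Quotient.lift (fixedIdeal p) (MvPolynomial.eval₂Hom (Int.castRingHom S) ![t', n', x']) <| by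
    intro a ha
    change a ∈ RingHom.ker _
    revert a
    change fixedIdeal p ≤ _
    rw [fixedIdeal, Ideal.span_le]
    rintro a (rfl | rfl)
    · simp [RingHom.mem_ker, pow_two, h1]
    · simp [RingHom.mem_ker, h2]

section lift

variable {S : Type*} [CommRing S] (t' n' x' : S) (h1 : t' * t' = p * t')
    (h2 : t' * x' ^ p = t' * n')

@[simp] theorem lift_t : lift p t' n' x' h1 h2 (t p) = t' := by
  simp [lift, t]

@[simp] theorem lift_n : lift p t' n' x' h1 h2 (n p) = n' := by
  simp [lift, n]

@[simp] theorem lift_x : lift p t' n' x' h1 h2 (x p) = x' := by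
  simp [lift, x]

end lift

/-- The restriction to the underlying level. -/
noncomputable def toPoly : FixedRing p →+* ℤ[X] :=
  lift p (p : ℤ[X]) (X ^ p) X rfl rfl

/-- The geometric fixed points: the quotient by the transfer ideal `(t)`, namely `ℤ[x][n]`. -/
noncomputable def geom : FixedRing p →+* ℤ[X][X] :=
  lift p 0 X (C X) (by simp) (by simp)

/-- Substitution of `x`, a section of the restriction. -/
noncomputable def ofPoly : ℤ[X] →+* FixedRing p := (aeval (x p)).toRingHom

/-- Substitution of `n`. -/
noncomputable def ofPolyN : ℤ[X] →+* FixedRing p := (aeval (n p)).toRingHom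

@[simp] theorem toPoly_t : toPoly p (t p) = p := by simp [toPoly]
@[simp] theorem toPoly_n : toPoly p (n p) = X ^ p := by simp [toPoly]
@[simp] theorem toPoly_x : toPoly p (x p) = X := by simp [toPoly]
@[simp] theorem geom_t : geom p (t p) = 0 := by simp [geom]
@[simp] theorem geom_n : geom p (n p) = X := by simp [geom]
@[simp] theorem geom_x : geom p (x p) = C X := by simp [geom]
@[simp] theorem ofPoly_X : ofPoly p X = x p := by simp [ofPoly]
@[simp] theorem ofPolyN_X : ofPolyN p X = n p := by simp [ofPolyN]

@[simp] theorem toPoly_ofPoly (f : ℤ[X]) : toPoly p (ofPoly p f) = f := by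
  have : (toPoly p).comp (ofPoly p) = RingHom.id _ := by
    ext <;> simp
  exact congr($this f)

theorem toPoly_ofPolyN (f : ℤ[X]) : toPoly p (ofPolyN p f) = expand ℤ p f := by
  have : (toPoly p).comp (ofPolyN p) = (expand ℤ p : ℤ[X] →+* ℤ[X]) := by
    ext <;> simp
  exact congr($this f)

/-- The geometric fixed points of `f(n)`, as a ring homomorphism in `f`. -/
theorem geom_ofPolyN (f : ℤ[X]) : geom p (ofPolyN p f) = f.map (Int.castRingHom ℤ[X]) := by
  have : (geom p).comp (ofPolyN p) = mapRingHom (Int.castRingHom ℤ[X]) := by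
    ext <;> simp
  exact congr($this f)

/-- After multiplication by `t`, the relations allow replacing `t` by `p` and `n` by `x ^ p`, which
is exactly what restriction does. -/
theorem t_mul_eq (a : FixedRing p) : t p * a = t p * ofPoly p (toPoly p a) := by
  obtain ⟨a, rfl⟩ := Ideal.Quotient.mk_surjective a
  induction a using MvPolynomial.induction_on with
  | C r => simp
  | add f g hf hg => rw [map_add, map_add, map_add, mul_add, hf, hg, mul_add]
  | mul_X f i hf =>
    suffices hi : t p * Ideal.Quotient.mk _ (MvPolynomial.X i) =
        t p * ofPoly p (toPoly p (Ideal.Quotient.mk _ (MvPolynomial.X i))) by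
      rw [map_mul, map_mul, map_mul]
      linear_combination Ideal.Quotient.mk (fixedIdeal p) (MvPolynomial.X i) * hf
        + ofPoly p (toPoly p (Ideal.Quotient.mk _ f)) * hi
    fin_cases i
    · change t p * t p = t p * ofPoly p (toPoly p (t p))
      rw [toPoly_t, map_natCast, t_sq, mul_comm]
    · change t p * n p = t p * ofPoly p (toPoly p (n p))
      rw [toPoly_n, map_pow, ofPoly_X, t_mul_x_pow]
    · change t p * x p = t p * ofPoly p (toPoly p (x p))
      rw [toPoly_x, ofPoly_X]

/-- Substituting `x` and `n` back into `geom p a` recovers `a` modulo `t`. -/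
theorem t_dvd_of_geom_eq_zero (a : FixedRing p) (h : geom p a = 0) : t p ∣ a := by
  let q : FixedRing p →+* FixedRing p ⧸ Ideal.span {t p} := Ideal.Quotient.mk (Ideal.span {t p})
  let s : ℤ[X][X] →+* FixedRing p := eval₂RingHom (ofPoly p) (n p)
  have hs : (q.comp s).comp (geom p) = q := by
    refine ringHom_ext (S := FixedRing p ⧸ Ideal.span {t p}) ?_ ?_ ?_
    · have : q (t p) = 0 := Ideal.Quotient.eq_zero_iff_mem.2 (Ideal.mem_span_singleton_self _)
      simp [this]
    · simp [s]
    · simp [s]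
  have : q a = 0 := by rw [← hs]; simp [h]
  exact Ideal.mem_span_singleton.1 (Ideal.Quotient.eq_zero_iff_mem.1 this)

variable {p} [Fact p.Prime]

/-- The first hypothesis gives `a = t * b`, whose restriction is `p` times that of `b`. Since `ℤ[x]`
has no `p`-torsion, `b` restricts to zero, and `t * b` depends only on this restriction. -/
theorem eq_zero_of_ghost {a : FixedRing p} (h1 : geom p a = 0) (h2 : toPoly p a = 0) : a = 0 := by
  obtain ⟨b, rfl⟩ := t_dvd_of_geom_eq_zero p a h1
  have hp : (p : ℤ[X]) ≠ 0 := Nat.cast_ne_zero.2 (Fact.out : p.Prime).ne_zero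
  rw [map_mul, toPoly_t, mul_eq_zero, or_iff_right hp] at h2
  rw [t_mul_eq, h2, map_zero, mul_zero]

theorem ghost_ext {a b : FixedRing p} (h1 : geom p a = geom p b) (h2 : toPoly p a = toPoly p b) :
    a = b :=
  sub_eq_zero.1 (eq_zero_of_ghost (by rw [map_sub, h1, sub_self]) (by rw [map_sub, h2, sub_self]))

theorem x_mul_cancel {a b : FixedRing p} (h : x p * a = x p * b) : a = b := by
  refine ghost_ext ?_ ?_
  · have := congrArg (geom p) h
    rw [map_mul, map_mul, geom_x] at this
    exact mul_left_cancel₀ (C_ne_zero.2 X_ne_zero) this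
  · have := congrArg (toPoly p) h
    rw [map_mul, map_mul, toPoly_x] at this
    exact mul_left_cancel₀ X_ne_zero this

/-! ### Construction of the norm and the Tambara functor -/

variable (p) in
-- Frobenius over `ZMod p`. The quotient `g` supplies the correction `t * g(x)` that turns `f(n)`
-- into the norm of `f`.
theorem exists_pow_eq_expand_add (f : ℤ[X]) : ∃ g : ℤ[X], f ^ p = expand ℤ p f + p * g := by
  have h : (C (p : ℤ)) ∣ f ^ p - expand ℤ p f := by
    rw [C_dvd_iff_dvd_coeff]
    intro i
    rw [← ZMod.intCast_zmod_eq_zero_iff_dvd _ p, ← eq_intCast (Int.castRingHom (ZMod p)),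
      ← coeff_map, Polynomial.map_sub, Polynomial.map_pow, map_expand, ZMod.expand_card, sub_self,
      coeff_zero]
  obtain ⟨g, hg⟩ := h
  refine ⟨g, ?_⟩
  rw [sub_eq_iff_eq_add] at hg
  rw [hg, add_comm]
  simp

theorem exists_norm (f : ℤ[X]) : ∃ a : FixedRing p,
    geom p a = f.map (Int.castRingHom ℤ[X]) ∧ toPoly p a = f ^ p := by
  obtain ⟨g, hg⟩ := exists_pow_eq_expand_add p f
  refine ⟨ofPolyN p f + t p * ofPoly p g, ?_, ?_⟩
  · simp [geom_ofPolyN]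
  · simp [toPoly_ofPolyN, hg]

/-- The norm of `f`: the element with geometric fixed points `f(n)` and restriction `f ^ p`. -/
noncomputable def norm : ℤ[X] →* FixedRing p where
  toFun f := (exists_norm f).choose
  map_one' := by
    obtain ⟨h1, h2⟩ := (exists_norm (p := p) 1).choose_spec
    exact ghost_ext (by rw [h1, Polynomial.map_one, map_one]) (by rw [h2, one_pow, map_one])
  map_mul' f g := by
    obtain ⟨h1, h2⟩ := (exists_norm (p := p) f).choose_spec
    obtain ⟨h3, h4⟩ := (exists_norm (p := p) g).choose_spec
    obtain ⟨h5, h6⟩ := (exists_norm (p := p) (f * g)).choose_spec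
    exact ghost_ext (by rw [map_mul, h1, h3, h5, Polynomial.map_mul])
      (by rw [map_mul, h2, h4, h6, mul_pow])

theorem geom_norm (f : ℤ[X]) : geom p (norm f) = f.map (Int.castRingHom ℤ[X]) :=
  (exists_norm f).choose_spec.1

theorem toPoly_norm (f : ℤ[X]) : toPoly p (norm f) = f ^ p :=
  (exists_norm f).choose_spec.2

variable (p) in
/-- The `C_p`-Tambara functor with fixed level `ℤ[t, n, x] / (t² = pt, tx^p = tn)` and underlying
level `ℤ[x]`. -/
noncomputable def tambara : CpTambaraFunctor p (FixedRing p) ℤ[X] where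
  res := toPoly p
  tr := (AddMonoidHom.mulLeft (t p)).comp (ofPoly p).toAddMonoidHom
  conj := 1
  conj_res _ _ := rfl
  tr_conj _ _ := rfl
  res_tr b := by simp [Cp]
  tr_res_mul a b := by
    change t p * ofPoly p (toPoly p a * b) = a * (t p * ofPoly p b)
    rw [map_mul, ← mul_assoc, ← t_mul_eq, mul_comm _ a, mul_assoc]
  nm := norm
  nm_conj _ _ := rfl
  res_nm b := by simp [toPoly_norm, Cp]
  nm_add R hR b c := by
    refine ghost_ext ?_ ?_
    · simp [geom_norm]
    · simp [toPoly_norm, hR.add_pow_eq b c, Finset.mul_sum]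

theorem tambara_hasLewisDiagram : HasLewisDiagram (tambara p) where
  conj_eq _ _ := rfl
  res_t := toPoly_t p
  res_x := toPoly_x p
  res_n := toPoly_n p
  tr_X := by simp [tambara]
  nm_X := ghost_ext (by simp [tambara, geom_norm]) (by simp [tambara, toPoly_norm])

end FixedRing

/-! ### Uniqueness and freeness -/

namespace HasLewisDiagram

open Polynomial

variable {p : ℕ} [Fact p.Prime] {T : CpTambaraFunctor p (FixedRing p) ℤ[X]}

theorem res_eq (h : HasLewisDiagram T) : T.res = FixedRing.toPoly p :=
  FixedRing.ringHom_ext (by simp [h.res_t]) (by simp [h.res_n]) (by simp [h.res_x])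

/-- Only `tr x` is prescribed; Frobenius reciprocity writes it as `x * tr 1`, and `x` is a
non-zero-divisor. -/
theorem tr_one (h : HasLewisDiagram T) : T.tr 1 = FixedRing.t p := by
  refine FixedRing.x_mul_cancel ?_
  rw [← T.tr_res_mul, h.res_x, mul_one, h.tr_X, mul_comm]

theorem tr_eq (h : HasLewisDiagram T) (f : ℤ[X]) :
    T.tr f = FixedRing.t p * FixedRing.ofPoly p f := by
  conv_lhs => rw [← mul_one f, ← FixedRing.toPoly_ofPoly p f, ← h.res_eq]
  rw [T.tr_res_mul, h.tr_one, mul_comm]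

theorem unique {T' : CpTambaraFunctor p (FixedRing p) ℤ[X]} (h : HasLewisDiagram T)
    (h' : HasLewisDiagram T') : T' = T := by
  have htr : ∀ b, T'.tr b = T.tr b := fun b => by rw [h.tr_eq, h'.tr_eq]
  have hconj : ∀ g b, T'.conj g b = T.conj g b := fun g b => by rw [h.conj_eq, h'.conj_eq]
  have hnm := CpTambaraFunctor.nm_compat_of_X T' T (RingHom.id _) (RingHom.id _) htr hconj
    (h'.nm_X.trans h.nm_X.symm)
  refine CpTambaraFunctor.ext (h'.res_eq.trans h.res_eq.symm) (AddMonoidHom.ext htr) ?_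
    (MonoidHom.ext hnm)
  exact MonoidHom.ext fun g => RingEquiv.ext (hconj g)

theorem isFreeOnFixed.{w, z} (h : HasLewisDiagram T) :
    CpTambaraFunctor.IsFreeOnFixed.{w, z, 0, 0} T (FixedRing.x p) := by
  intro A' B' _ _ T' a
  have hprod : ∏ g : Cp p, T'.conj g (T'.res a) = T'.res a ^ p := by
    simp [T'.conj_res, Cp]
  have h1 : T'.tr 1 * T'.tr 1 = p * T'.tr 1 := by
    rw [← T'.tr_res_mul, mul_one, T'.res_tr, ← T'.tr_res_mul]
    simp [Cp]
  have h2 : T'.tr 1 * a ^ p = T'.tr 1 * T'.nm (T'.res a) := by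
    rw [mul_comm, ← T'.tr_res_mul, mul_comm (T'.tr 1), ← T'.tr_res_mul, T'.res_nm, hprod, map_pow]
  let α : FixedRing p →+* A' := FixedRing.lift p (T'.tr 1) (T'.nm (T'.res a)) a h1 h2
  let β : ℤ[X] →+* B' := (aeval (T'.res a)).toRingHom
  have hβX : β X = T'.res a := by simp [β]
  have hres : β.comp T.res = T'.res.comp α := by
    refine FixedRing.ringHom_ext ?_ ?_ ?_
    · simp [h.res_t, α, T'.res_tr, Cp]
    · simp [h.res_n, α, T'.res_nm, hprod, hβX]
    · simp [h.res_x, α, hβX]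
  -- Every value of `β` is thus a restriction, hence fixed by conjugation and with transfer computed
  -- by reciprocity.
  have hres' : T'.res.comp (α.comp (FixedRing.ofPoly p)) = β := by
    rw [← RingHom.comp_assoc, ← hres, h.res_eq]
    ext <;> simp
  have htr : ∀ b, α (T.tr b) = T'.tr (β b) := by
    intro b
    have hb : T'.res (α (FixedRing.ofPoly p b)) = β b := congr($hres' b)
    rw [h.tr_eq, map_mul, ← hb, ← mul_one (T'.res _), T'.tr_res_mul, mul_comm]
    simp [α]
  have hconj : ∀ g b, β (T.conj g b) = T'.conj g (β b) := by
    intro g b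
    have hb : T'.res (α (FixedRing.ofPoly p b)) = β b := congr($hres' b)
    rw [h.conj_eq, ← hb, T'.conj_res]
  have hnm := CpTambaraFunctor.nm_compat_of_X T T' α β htr hconj (by simp [h.nm_X, α, hβX])
  refine ⟨⟨α, β, fun b => congr($hres b), htr, hnm, hconj⟩, by simp [α], ?_⟩
  intro φ hφ
  have hX : φ.underlying X = T'.res a := by rw [← h.res_x, φ.map_res, hφ]
  refine CpTambaraHom.ext (FixedRing.ringHom_ext ?_ ?_ ?_) ?_
  · rw [← h.tr_one, φ.map_tr, htr, map_one β, map_one φ.underlying]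
  · rw [← h.nm_X, φ.map_nm, hnm, hX, hβX]
  · simp [hφ, α]
  · exact Polynomial.ringHom_ext (fun r => by simp) (hX.trans hβX.symm)

end HasLewisDiagram

theorem proposition3p5 (p : ℕ) [Fact p.Prime] :
    ∃ T : CpTambaraFunctor p (FixedRing p) (Polynomial ℤ),
      HasLewisDiagram T ∧
      (∀ T' : CpTambaraFunctor p (FixedRing p) (Polynomial ℤ), HasLewisDiagram T' → T' = T) ∧
      CpTambaraFunctor.IsFreeOnFixed.{u, v, 0, 0} T (FixedRing.x p) := by
  exact ⟨FixedRing.tambara p, FixedRing.tambara_hasLewisDiagram,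
    fun _ h' => FixedRing.tambara_hasLewisDiagram.unique h',
    FixedRing.tambara_hasLewisDiagram.isFreeOnFixed⟩
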